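/- **Setting.** Let $\mathcal S$ be a finite non-empty set of states and $\mathcal X$ a measurable covariate space with a reference measure $dx$. Units $i=1,2,\dots$ arrive sequentially with covariate $X_i\in\mathcal X$, state $S_i\in\mathcal S$, treatment $W_i\in\{0,1\}$ and outcome $Y_i\in\mathbb R$. A policy is a measurable map $\pi:\mathcal X\times\mathcal S\to[0,1]$; under $\pi$, the treatment $W_i$ equals $1$ with probability $\pi(X_i,S_i)$. Conditionally on the past, $X_i$, $Y_i$ and $S_{i+1}$ are drawn from a density $P_X(\cdot)$ with respect to $dx$, from $P_Y(\cdot\mid X_i,S_i,W_i)$ and from $P_S(\cdot\mid S_i,W_i)$, respectively; these distributions do not depend on $i$. Assume that the process $(S_i)$ induced by any policy is irreducible and aperiodic, and that the outcomes are uniformly bounded almost surely. For a policy $\pi$, let $d_\pi$ be the stationary distribution of $(S_i)$ and $$\mu(\pi)=\int_{\mathcal X}\sum_{s\in\mathcal S}P_X(x)\,d_\pi(s)\,\mathbb E_\pi[Y_i\mid S_i=s,X_i=x]\,dx .$$ Then $d_\pi$ exists, is unique and is strictly positive, and $\mu(\pi)=\lim_{n\to\infty}\mathbb E_\pi\big[\tfrac1n\sum_{i=1}^nY_i\mid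 S_1=s\big]$ for every $s$. The gradient $\partial\mu(\pi)/\partial\pi(x,s)$ is the functional derivative with respect to $dx$: the function $G(x,s)$, integrable in $x$ and unique up to $dx$-null sets, such that for every measurable $h:\mathcal X\times\mathcal S\to\mathbb R$ the derivative of $t\mapsto\mu(\pi+th)$ at $t=0$, taken along those $t$ for which $\pi+th$ is a policy (a condition only if there are such $t\neq0$), equals $\int_{\mathcal X}\sum_sG(x,s)h(x,s)\,dx$. When $\mathcal X$ is discrete and $dx$ is counting measure, this is the ordinary partial derivative of $\mu$ in the number $\pi(x,s)$. The conditional policy gradient is $$H(x,s;\pi)=\frac{1}{P_X(x)\,d_\pi(s)}\,\frac{\partial}{\partial\pi(x,s)}\mu(\pi).$$ **Proposition.** For every policy $\pi$ the gradient exists, and for $P_X$-almost every $x$ and all $s\in\mathcal S$, $$H(x,s;\pi)=\tau(x,s)+C_\pi(s),$$ where $$\tau(x,s)=\mathbb E[Y_i\mid X_i=x,S_i=s,W_i=1]-\mathbb E[Y_i\mid X_i=x,S_i=s,W_i=0]$$ is the conditional average direct effect and $$C_\pi(s)=\lim_{n\to\infty}\mathbb E_\pi\Big[\sum_{i=2}^n\big(Y_i-\mu(\pi)\big)\,\Big|\,S_1=s,W_1=1\Big]-\lim_{n\to\infty}\mathbb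 E_\pi\Big[\sum_{i=2}^n\big(Y_i-\mu(\pi)\big)\,\Big|\,S_1=s,W_1=0\Big]$$ is the conditional average indirect effect; both limits exist and are finite. (If $W_1=w$ has probability $0$ given $S_1=s$ under $\pi$, the conditional expectation refers to the process in which the first unit is assigned $w$ and all later units follow $\pi$.) Moreover, for every $x$ such that $\{x\}$ is measurable and every $s$, the derivative of $\mu$ in the single value $\pi(x,s)\in[0,1]$, all other values of $\pi$ being fixed, exists and equals $\mathbb P(X_i=x)\,d_\pi(s)\,\big(\tau(x,s)+C_\pi(s)\big)$. -/

import Mathlib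

open MeasureTheory ProbabilityTheory Filter Topology
open scoped ENNReal NNReal

namespace DynamicTargeting

noncomputable section

/-- A function `(x, s) ↦ π x s` is a targeting rule (policy) if it is measurable in the covariate and
takes values in `[0, 1]`; `π x s` is the probability of treating a unit with covariate `x` that
arrives in state `s`. -/
structure IsPolicy {X S : Type*} [MeasurableSpace X] (π : X → S → ℝ) : Prop where
  measurable : ∀ s, Measurable fun x => π x s
  nonneg : ∀ x s, 0 ≤ π x s
  le_one : ∀ x s, π x s ≤ 1

/-- The set of all policies. -/
def Policy (X S : Type*) [MeasurableSpace X] : Type _ := {π : X → S → ℝ // IsPolicy π}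

/-- The policy that gives every unit the treatment `w` (`true` = treated, `false` = untreated). -/
def Policy.const (X S : Type*) [MeasurableSpace X] (w : Bool) : Policy X S :=
  ⟨fun _ _ => if w then 1 else 0,
    ⟨fun _ => measurable_const, fun _ _ => by split_ifs <;> norm_num,
      fun _ _ => by split_ifs <;> norm_num⟩⟩

/-- The time-homogeneous distributions that govern a Markov decision process with exogenous
covariates: the density `pX` of the covariates with respect to a reference measure `ν` (written
`dx`), the outcome distributions `PY (x, s, w)`, and the state transition probabilities
`PS s w s'`. -/
structure MDP (X S : Type*) [MeasurableSpace X] [MeasurableSpace S] where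
  ν : Measure X
  pX : X → ℝ≥0
  measurable_pX : Measurable pX
  lintegral_pX : ∫⁻ x, (pX x : ℝ≥0∞) ∂ν = 1
  PY : Kernel (X × S × Bool) ℝ
  markov_PY : IsMarkovKernel PY
  PS : S → Bool → PMF S

/-- The record `(S_i, ((X_i, W_i), Y_i))` of one unit. -/
abbrev Obs (X S : Type*) : Type _ := S × ((X × Bool) × ℝ)

namespace MDP

variable {X S : Type*} [MeasurableSpace X] [MeasurableSpace S]

instance (M : MDP X S) : IsMarkovKernel M.PY := M.markov_PY

/-- The covariate distribution `P_X(x) dx`. -/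
def covLaw (M : MDP X S) : Measure X := M.ν.withDensity fun x => (M.pX x : ℝ≥0∞)

instance (M : MDP X S) : IsProbabilityMeasure M.covLaw :=
  ⟨by rw [covLaw, withDensity_apply _ MeasurableSet.univ, setLIntegral_univ, M.lintegral_pX]⟩

/-- `E[Y_i | X_i = x, S_i = s, W_i = w]`. -/
def meanOutcome (M : MDP X S) (x : X) (s : S) (w : Bool) : ℝ := ∫ y, y ∂M.PY (x, s, w)

/-- The conditional average direct effect `τ(x, s)`. -/
def cade (M : MDP X S) (x : X) (s : S) : ℝ := M.meanOutcome x s true - M.meanOutcome x s false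

/-- The outcomes are uniformly bounded almost surely. -/
def BoundedOutcomes (M : MDP X S) : Prop :=
  ∃ B : ℝ, ∀ᵐ x ∂M.covLaw, ∀ s w, ∀ᵐ y ∂M.PY (x, s, w), |y| ≤ B

section Dynamics

variable [Countable S] [MeasurableSingletonClass S]

/-- The treatment is Bernoulli: `W_i = 1` with probability `π (X_i, S_i)`. -/
def treatKernel (π : Policy X S) : Kernel (S × X) Bool where
  toFun p := ENNReal.ofReal (π.1 p.2 p.1) • Measure.dirac true
    + ENNReal.ofReal (1 - π.1 p.2 p.1) • Measure.dirac false
  measurable' := by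
    have h : Measurable fun p : S × X => π.1 p.2 p.1 :=
      measurable_from_prod_countable_right fun s => π.2.measurable s
    refine Measure.measurable_of_measurable_coe _ fun t _ => ?_
    simp only [Measure.add_apply, Measure.smul_apply, smul_eq_mul]
    exact (h.ennreal_ofReal.mul_const _).add ((h.const_sub 1).ennreal_ofReal.mul_const _)

instance (π : Policy X S) : IsMarkovKernel (treatKernel π) := by
  refine ⟨fun p => ⟨?_⟩⟩
  change (ENNReal.ofReal (π.1 p.2 p.1) • Measure.dirac true
    + ENNReal.ofReal (1 - π.1 p.2 p.1) • Measure.dirac false : Measure Bool) Set.univ = 1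
  have h0 := π.2.nonneg p.2 p.1
  have h1 := π.2.le_one p.2 p.1
  simp only [Measure.add_apply, Measure.smul_apply, measure_univ, smul_eq_mul, mul_one]
  rw [← ENNReal.ofReal_add h0 (by linarith)]
  simp

/-- The outcome kernel, from `(S_i, (X_i, W_i))` to `Y_i`. -/
def outcomeKernel (M : MDP X S) : Kernel (S × (X × Bool)) ℝ :=
  M.PY.comap (fun p => (p.2.1, p.1, p.2.2)) (by fun_prop)

instance (M : MDP X S) : IsMarkovKernel M.outcomeKernel := by
  unfold outcomeKernel; infer_instance

/-- The law of the record of a unit that arrives in a given state under the policy `π`: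
`X_i ∼ P_X`, then `W_i ∼ π (X_i, S_i)`, then `Y_i ∼ P_Y (· | X_i, S_i, W_i)`. -/
def unitKernel (M : MDP X S) (π : Policy X S) : Kernel S (Obs X S) :=
  Kernel.id ×ₖ ((Kernel.const S M.covLaw ⊗ₖ treatKernel π) ⊗ₖ M.outcomeKernel)

instance (M : MDP X S) (π : Policy X S) : IsMarkovKernel (M.unitKernel π) := by
  unfold unitKernel; infer_instance

/-- The state transition kernel, from `(S_i, W_i)` to `S_{i+1}`. -/
def stateKernel (M : MDP X S) : Kernel (S × Bool) S :=
  Kernel.ofFunOfCountable fun p => (M.PS p.1 p.2).toMeasure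

instance (M : MDP X S) : IsMarkovKernel M.stateKernel :=
  ⟨fun p => PMF.toMeasure.isProbabilityMeasure (M.PS p.1 p.2)⟩

/-- The law of the record of the next unit, given the record of the current one. -/
def stepKernel (M : MDP X S) (π : Policy X S) : Kernel (Obs X S) (Obs X S) :=
  M.unitKernel π ∘ₖ M.stateKernel.comap (fun z => (z.1, z.2.1.2)) (by fun_prop)

instance (M : MDP X S) (π : Policy X S) : IsMarkovKernel (M.stepKernel π) := by
  unfold stepKernel; infer_instance

/-- The law of the record of unit `n + 1`, given the records of all the earlier units. -/
def historyKernel (M : MDP X S) (π : Policy X S) (n : ℕ) :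
    Kernel ((_ : Finset.Iic n) → Obs X S) (Obs X S) :=
  (M.stepKernel π).comap (fun h => h ⟨n, Finset.mem_Iic.2 le_rfl⟩) (by fun_prop)

instance (M : MDP X S) (π : Policy X S) (n : ℕ) : IsMarkovKernel (M.historyKernel π n) := by
  unfold historyKernel; infer_instance

/-- The law of the whole process when the record of the first unit has law `init` and all later
units follow the policy `π`. Time is counted from `0`, so the unit `i` of the process is at the
coordinate `i - 1`. -/
def pathLaw (M : MDP X S) (π : Policy X S) (init : Measure (Obs X S)) : Measure (ℕ → Obs X S) :=
  Kernel.trajMeasure (X := fun _ => Obs X S) init (M.historyKernel π)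

/-- The treatment at the coordinate `i` of a path. -/
def treatmentAt (i : ℕ) (ω : ℕ → Obs X S) : Bool := (ω i).2.1.2

/-- The outcome at the coordinate `i` of a path. -/
def outcomeAt (i : ℕ) (ω : ℕ → Obs X S) : ℝ := (ω i).2.2

/-- The law of the process under `π`, given `S_1 = s`. -/
def lawGivenState (M : MDP X S) (π : Policy X S) (s : S) : Measure (ℕ → Obs X S) :=
  M.pathLaw π (M.unitKernel π s)

open Classical in
/-- The law of the process under `π`, given `S_1 = s` and `W_1 = w`. If `W_1 = w` has positive
probability in state `s`, this is the elementary conditional law. If it has probability `0`, it is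
the law of the process in which the first unit arrives in state `s` and is assigned the treatment
`w`, and all later units follow `π`. -/
def lawGivenStateTreatment (M : MDP X S) (π : Policy X S) (s : S) (w : Bool) :
    Measure (ℕ → Obs X S) :=
  if M.lawGivenState π s {ω | treatmentAt 0 ω = w} = 0 then
    M.pathLaw π (M.unitKernel (Policy.const X S w) s)
  else ProbabilityTheory.cond (M.lawGivenState π s) {ω | treatmentAt 0 ω = w}

end Dynamics

section Stationary

variable [Fintype S]

/-- The transition matrix of the state process `S_1, S_2, …` under `π`:
`P(S_{i+1} = s' | S_i = s) = ∫ ∑_w π_w(x, s) P_S(s' | s, w) P_X(x) dx`. -/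
def transMatrix (M : MDP X S) (π : X → S → ℝ) : Matrix S S ℝ :=
  Matrix.of fun s s' => ∫ x, (π x s * (M.PS s true s').toReal
    + (1 - π x s) * (M.PS s false s').toReal) ∂M.covLaw

/-- `d` is a stationary distribution of the state process under `π`. -/
structure IsStationary (M : MDP X S) (π : X → S → ℝ) (d : S → ℝ) : Prop where
  nonneg : ∀ s, 0 ≤ d s
  sum_eq_one : ∑ s, d s = 1
  invariant : ∀ s', ∑ s, d s * M.transMatrix π s s' = d s'

open Classical in
/-- The stationary distribution `d_π` of the state process (`0` if there is none). -/
def statDist (M : MDP X S) (π : X → S → ℝ) : S → ℝ :=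
  if h : ∃ d, M.IsStationary π d then h.choose else 0

/-- The average outcome
`μ(π) = ∫ ∑_s P_X(x) d_π(s) E_π[Y_i | S_i = s, X_i = x] dx`. -/
def avgOutcome (M : MDP X S) (π : X → S → ℝ) : ℝ :=
  ∫ x, ∑ s, M.statDist π s * (π x s * M.meanOutcome x s true
    + (1 - π x s) * M.meanOutcome x s false) ∂M.covLaw

/-- `G` is the gradient `(x, s) ↦ ∂μ(π)/∂π(x, s)` with respect to the reference measure `dx`: for
every direction `h`, along the values of `t` for which `π + t h` is a policy, the derivative of
`μ(π + t h)` at `t = 0` is `∫ ∑_s G(x, s) h(x, s) dx`. -/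
def HasPolicyGradient (M : MDP X S) (π : X → S → ℝ) (G : X → S → ℝ) : Prop :=
  (∀ s, Integrable (fun x => G x s) M.ν) ∧
  ∀ h : X → S → ℝ, (∀ s, Measurable fun x => h x s) →
    HasDerivWithinAt (fun t : ℝ => M.avgOutcome fun x s => π x s + t * h x s)
      (∫ x, ∑ s, G x s * h x s ∂M.ν) {t : ℝ | IsPolicy fun x s => π x s + t * h x s} 0

/-- The conditional policy gradient `H(x, s; π)` that belongs to the gradient `G`. -/
def condPolicyGradient (M : MDP X S) (π : X → S → ℝ) (G : X → S → ℝ) (x : X) (s : S) : ℝ :=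
  1 / (M.pX x * M.statDist π s) * G x s

variable [MeasurableSingletonClass S]

/-- `E_π[∑_{i=2}^n (Y_i - μ(π)) | S_1 = s, W_1 = w]`. -/
def centredTail (M : MDP X S) (π : Policy X S) (s : S) (w : Bool) (n : ℕ) : ℝ :=
  ∫ ω, ∑ i ∈ Finset.Icc 2 n, (outcomeAt (i - 1) ω - M.avgOutcome π.1)
    ∂M.lawGivenStateTreatment π s w

/-- The conditional average indirect effect `C_π(s)`. -/
def caie (M : MDP X S) (π : Policy X S) (s : S) : ℝ :=
  limUnder atTop (M.centredTail π s true) - limUnder atTop (M.centredTail π s false)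

end Stationary

end MDP

/-- The policy `π` with its value at the single point `(x, s)` replaced by `p`. -/
def setAt {X S : Type*} (π : X → S → ℝ) (x : X) (s : S) (p : ℝ) : X → S → ℝ :=
  open Classical in fun x' s' => if x' = x ∧ s' = s then p else π x' s'

/-- All states of a chain with transition matrix `P` have period one. -/
def IsAperiodic {S : Type*} [Fintype S] [DecidableEq S] (P : Matrix S S ℝ) : Prop :=
  ∀ s, ∀ d : ℕ, (∀ n : ℕ, 0 < n → 0 < (P ^ n) s s → d ∣ n) → d = 1

end

end DynamicTargeting

/-! The proof compares two policies exactly instead of differentiating the stationary distribution.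
Let V solve the Poisson equation V = f - d_π·f + P_π V, where f is the mean reward under π.
Invariance of d_π' under P_π' yields the performance difference formula `avgOutcome_sub`: μ(π') -
μ(π) is the d_π'-average of ∫ (π' - π)(τ + ΔV) dP_X, where ΔV(s) is the effect of treatment in state
s on the expectation of V at the next state. For π' = π + th, division by t leaves d_π' as the only
factor that depends on t, so continuity of the stationary distribution at π suffices. This
continuity comes from the same identity, with the indicator of a state as the reward of both
policies (`abs_statDist_sub_le`).

It remains to identify ΔV with C_π. By the Poisson equation the partial sums of P_π^k f - μ(π)
telescope and converge to V - d_π·V (`tendsto_sum_pow_mulVec`). Given S_1 = s and W_1 = w, the state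
S_2 has law P_S(·|s,w) and the chain of π takes over, so each limit in C_π(s) is the P_S(·|s,w)-mean
of V - d_π·V. The constant cancels in the difference (`caie_eq_indirectEffect`). Convergence and
solvability rest on a positive power of P_π, which contracts the functions of d_π-mean zero
(`tendsto_pow_mulVec_zero`). -/

namespace DynamicTargeting

/-! ### Primitive stochastic matrices and the Poisson equation -/

section StochasticMatrix

open Matrix

variable {S : Type*} [Fintype S] {P : Matrix S S ℝ}

theorem norm_mulVec_le_of_nonneg {Q : Matrix S S ℝ} (hQ : ∀ i j, 0 ≤ Q i j) {c : ℝ} (hc : 0 ≤ c)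
    (hsum : ∀ i, ∑ j, Q i j ≤ c) (f : S → ℝ) : ‖Q *ᵥ f‖ ≤ c * ‖f‖ := by
  refine (pi_norm_le_iff_of_nonneg (by positivity)).2 fun i => ?_
  calc ‖(Q *ᵥ f) i‖ ≤ ∑ j, ‖Q i j * f j‖ := norm_sum_le _ _
    _ ≤ ∑ j, Q i j * ‖f‖ := by
        refine Finset.sum_le_sum fun j _ => ?_
        rw [norm_mul, Real.norm_of_nonneg (hQ i j)]
        exact mul_le_mul_of_nonneg_left (norm_le_pi_norm f j) (hQ i j)
    _ ≤ c * ‖f‖ := by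
        rw [← Finset.sum_mul]
        exact mul_le_mul_of_nonneg_right (hsum i) (norm_nonneg _)

/-- The difference of the average rewards of two stochastic matrices, in terms of a solution of
the Poisson equation of the first one. -/
theorem dotProduct_sub_of_poisson {P' : Matrix S S ℝ} {d d' f f' V : S → ℝ}
    (hd1 : ∑ s, d' s = 1) (hd : d' ᵥ* P' = d')
    (hV : ∀ s, V s = f s - d ⬝ᵥ f + (P *ᵥ V) s) :
    d' ⬝ᵥ f' - d ⬝ᵥ f = d' ⬝ᵥ (f' - f + (P' - P) *ᵥ V) := by
  have hf : f = V - P *ᵥ V + (d ⬝ᵥ f) • 1 := by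
    funext s
    have := hV s
    simp only [Pi.add_apply, Pi.sub_apply, Pi.smul_apply, Pi.one_apply, smul_eq_mul, mul_one]
    linarith
  have hone : d' ⬝ᵥ (1 : S → ℝ) = 1 := by simpa [dotProduct] using hd1
  have h1 : d' ⬝ᵥ f = d' ⬝ᵥ V - d' ⬝ᵥ (P *ᵥ V) + d ⬝ᵥ f := by
    conv_lhs => rw [hf]
    rw [dotProduct_add, dotProduct_sub, dotProduct_smul, hone, smul_eq_mul, mul_one]
  -- Only the invariance of `d'` under `P'` enters; `d` may be any vector.
  rw [dotProduct_add, dotProduct_sub, sub_mulVec, dotProduct_sub, dotProduct_mulVec d' P', hd]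
  linarith

variable [DecidableEq S]

/-- An irreducible aperiodic matrix is primitive. -/
theorem exists_pow_pos (hirr : P.IsIrreducible) (haper : IsAperiodic P) :
    ∃ m, ∀ i j, 0 < (P ^ m) i j := by
  have h0 := hirr.nonneg
  have hp (n : ℕ) (i j : S) : 0 ≤ (P ^ n) i j := Matrix.pow_apply_nonneg h0 n i j
  have hmul {a b : ℕ} {i j k : S} (ha : 0 < (P ^ a) i j) (hb : 0 < (P ^ b) j k) :
      0 < (P ^ (a + b)) i k := by
    rw [pow_add, mul_apply]
    exact Finset.sum_pos' (fun x _ => mul_nonneg (hp _ _ _) (hp _ _ _))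
      ⟨j, Finset.mem_univ _, mul_pos ha hb⟩
  have hret (s : S) : ∃ N, ∀ n ≥ N, 0 < (P ^ n) s s := by
    -- The return times to `s` are closed under addition and have gcd one, so they contain every
    -- large integer.
    let R : AddSubmonoid ℕ :=
      { carrier := {n | 0 < (P ^ n) s s}
        zero_mem' := by simp
        add_mem' := fun ha hb => hmul ha hb }
    obtain ⟨N, hN⟩ := Nat.exists_mem_closure_of_ge (R : Set ℕ)
    have hgcd : Nat.setGcd (R : Set ℕ) = 1 :=
      haper s _ fun n _ hn => Nat.setGcd_dvd_of_mem (s := (R : Set ℕ)) hn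
    refine ⟨N, fun n hn => ?_⟩
    have := hN n hn (by rw [hgcd]; exact one_dvd n)
    rw [AddSubmonoid.closure_eq] at this
    exact this
  choose N hN using hret
  choose k _ hk using (isIrreducible_iff_exists_pow_pos h0).1 hirr
  -- A common exponent for all pairs: after the `k i j` steps from `i` to `j` are set aside, at
  -- least `N i` steps remain, enough for a return to `i` beforehand.
  refine ⟨∑ s, N s + ∑ s, ∑ t, k s t, fun i j => ?_⟩
  have h1 : N i ≤ ∑ s, N s := Finset.single_le_sum (fun _ _ => Nat.zero_le _) (Finset.mem_univ i)
  have h2 : k i j ≤ ∑ s, ∑ t, k s t :=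
    (Finset.single_le_sum (f := fun t => k i t) (fun _ _ => Nat.zero_le _)
      (Finset.mem_univ j)).trans
      (Finset.single_le_sum (f := fun s => ∑ t, k s t) (fun _ _ => Nat.zero_le _)
        (Finset.mem_univ i))
  have := hmul (hN i (∑ s, N s + ∑ s, ∑ t, k s t - k i j) (by omega)) (hk i j)
  rwa [Nat.sub_add_cancel (by omega)] at this

theorem pow_mulVec_one (hsum : P *ᵥ 1 = 1) (n : ℕ) : P ^ n *ᵥ 1 = 1 := by
  induction n with
  | zero => simp
  | succ n ih => rw [pow_succ, ← mulVec_mulVec, hsum, ih]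

theorem vecMul_pow_eq_self {d : S → ℝ} (hd : d ᵥ* P = d) (n : ℕ) : d ᵥ* P ^ n = d := by
  induction n with
  | zero => simp
  | succ n ih => rw [pow_succ, ← vecMul_vecMul, ih, hd]

/-- A stochastic matrix with a positive power has a positive stationary distribution. -/
theorem exists_stationary [Nonempty S] (h0 : ∀ i j, 0 ≤ P i j) (hsum : P *ᵥ 1 = 1) {m : ℕ}
    (hm : ∀ i j, 0 < (P ^ m) i j) :
    ∃ d : S → ℝ, (∀ s, 0 < d s) ∧ ∑ s, d s = 1 ∧ d ᵥ* P = d := by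
  have hrow (i : S) : ∑ j, P i j = 1 := by
    simpa [mulVec, dotProduct] using congrFun hsum i
  have hdet : (P - 1).det = 0 := by
    refine exists_mulVec_eq_zero_iff.1 ⟨1, one_ne_zero, ?_⟩
    rw [sub_mulVec, hsum, one_mulVec, sub_self]
  obtain ⟨v, hv0, hv⟩ := exists_vecMul_eq_zero_iff.2 hdet
  rw [vecMul_sub, vecMul_one, sub_eq_zero] at hv
  -- The left fixed vector `v` has unknown signs. Its absolute value is dominated entrywise by its
  -- image under `P`, and both have the same total because rows sum to one, so the absolute value is
  -- itself invariant.
  have hle (j : S) : |v j| ≤ ∑ i, |v i| * P i j := by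
    calc |v j| = |∑ i, v i * P i j| := by rw [← congrFun hv j]; rfl
      _ ≤ ∑ i, |v i * P i j| := Finset.abs_sum_le_sum_abs _ _
      _ = _ := by simp_rw [abs_mul, abs_of_nonneg (h0 _ _)]
  have htot : ∑ j, |v j| = ∑ j, ∑ i, |v i| * P i j := by
    rw [Finset.sum_comm]
    simp_rw [← Finset.mul_sum, hrow, mul_one]
  have heq := (Finset.sum_eq_sum_iff_of_le fun j _ => hle j).1 htot
  set u : S → ℝ := fun s => |v s|
  have hu : u ᵥ* P = u := funext fun j => (heq j (Finset.mem_univ j)).symm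
  obtain ⟨a, ha⟩ := Function.ne_iff.1 hv0
  have hpos (s : S) : 0 < u s := by
    rw [← vecMul_pow_eq_self hu m]
    exact Finset.sum_pos' (fun i _ => mul_nonneg (abs_nonneg _) (hm _ _).le)
      ⟨a, Finset.mem_univ _, mul_pos (abs_pos.2 ha) (hm _ _)⟩
  have hU : 0 < ∑ s, u s := Finset.sum_pos (fun s _ => hpos s) Finset.univ_nonempty
  refine ⟨(∑ s, u s)⁻¹ • u, fun s => mul_pos (inv_pos.2 hU) (hpos s), ?_, ?_⟩
  · simp only [Pi.smul_apply, smul_eq_mul]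
    rw [← Finset.mul_sum, inv_mul_cancel₀ hU.ne']
  · rw [smul_vecMul, hu]

/-- Convergence to the stationary distribution, for functions of mean zero. -/
theorem tendsto_pow_mulVec_zero [Nonempty S] (h0 : ∀ i j, 0 ≤ P i j) (hsum : P *ᵥ 1 = 1) {m : ℕ}
    (hm : ∀ i j, 0 < (P ^ m) i j) {d : S → ℝ} (hd0 : ∀ s, 0 ≤ d s) (hd1 : ∑ s, d s = 1)
    (hd : d ᵥ* P = d) {f : S → ℝ} (hf : d ⬝ᵥ f = 0) :
    Tendsto (fun n : ℕ => P ^ n *ᵥ f) atTop (𝓝 0) := by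
  have hrow (n : ℕ) (i : S) : ∑ j, (P ^ n) i j = 1 := by
    simpa [mulVec, dotProduct] using congrFun (pow_mulVec_one hsum n) i
  have hdle (s : S) : d s ≤ 1 :=
    hd1 ▸ Finset.single_le_sum (fun i _ => hd0 i) (Finset.mem_univ s)
  obtain ⟨⟨a, b⟩, hab⟩ := Finite.exists_min fun p : S × S => (P ^ m) p.1 p.2
  set ε := (P ^ m) a b
  have hε : 0 < ε := hm a b
  have hε1 : ε ≤ 1 := by
    rw [← hrow m a]
    exact Finset.single_le_sum (fun j _ => (hm a j).le) (Finset.mem_univ b)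
  -- Doeblin's trick: removing `ε * d` from every row changes nothing on functions of mean zero,
  -- keeps the entries nonnegative since `d j ≤ 1`, and lowers the row sums to `1 - ε`.
  let Q : Matrix S S ℝ := Matrix.of fun i j => (P ^ m) i j - ε * d j
  have hQ (g : S → ℝ) (hg : d ⬝ᵥ g = 0) : P ^ m *ᵥ g = Q *ᵥ g := by
    funext i
    simp only [Q, mulVec, dotProduct, of_apply, sub_mul, Finset.sum_sub_distrib, mul_assoc,
      ← Finset.mul_sum]
    simp only [dotProduct] at hg
    rw [hg, mul_zero, sub_zero]
  have hcontr (g : S → ℝ) (hg : d ⬝ᵥ g = 0) : ‖P ^ m *ᵥ g‖ ≤ (1 - ε) * ‖g‖ := by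
    rw [hQ g hg]
    refine norm_mulVec_le_of_nonneg (fun i j => ?_) (by linarith) (fun i => ?_) g
    · have := hab (i, j)
      simp only [Q, of_apply]
      nlinarith [mul_le_mul_of_nonneg_left (hdle j) hε.le]
    · simp only [Q, of_apply, Finset.sum_sub_distrib, ← Finset.mul_sum, hrow, hd1, mul_one, le_refl]
  have hmean (n : ℕ) : d ⬝ᵥ (P ^ n *ᵥ f) = 0 := by
    rw [dotProduct_mulVec, vecMul_pow_eq_self hd, hf]
  have hgeom (k : ℕ) : ‖P ^ (m * k) *ᵥ f‖ ≤ (1 - ε) ^ k * ‖f‖ := by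
    induction k with
    | zero => simp
    | succ k ih =>
      rw [mul_add, mul_one, add_comm, pow_add, ← mulVec_mulVec]
      refine (hcontr _ (hmean _)).trans ?_
      rw [pow_succ', mul_assoc]
      exact mul_le_mul_of_nonneg_left ih (by linarith)
  -- Monotonicity extends the decay along multiples of `m` to all exponents.
  have hanti : Antitone fun n : ℕ => ‖P ^ n *ᵥ f‖ := antitone_nat_of_succ_le fun n => by
    rw [pow_succ', ← mulVec_mulVec]
    refine (norm_mulVec_le_of_nonneg h0 zero_le_one (fun i => ?_) _).trans (one_mul _).le
    simpa using (hrow 1 i).le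
  have hbound : Tendsto (fun k : ℕ => (1 - ε) ^ k * ‖f‖) atTop (𝓝 0) := by
    simpa using (tendsto_pow_atTop_nhds_zero_of_lt_one (by linarith) (by linarith)).mul_const ‖f‖
  rw [tendsto_zero_iff_norm_tendsto_zero, Metric.tendsto_atTop]
  intro δ hδ
  obtain ⟨K, hK⟩ := (hbound.eventually (gt_mem_nhds hδ)).exists
  refine ⟨m * K, fun n hn => ?_⟩
  simp only [dist_zero_right, norm_norm]
  exact ((hanti hn).trans (hgeom K)).trans_lt hK

theorem tendsto_pow_mulVec [Nonempty S] (h0 : ∀ i j, 0 ≤ P i j) (hsum : P *ᵥ 1 = 1) {m : ℕ}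
    (hm : ∀ i j, 0 < (P ^ m) i j) {d : S → ℝ} (hd0 : ∀ s, 0 ≤ d s) (hd1 : ∑ s, d s = 1)
    (hd : d ᵥ* P = d) (f : S → ℝ) :
    Tendsto (fun n : ℕ => P ^ n *ᵥ f) atTop (𝓝 fun _ => d ⬝ᵥ f) := by
  have hone : d ⬝ᵥ (1 : S → ℝ) = 1 := by simpa [dotProduct] using hd1
  have h := tendsto_pow_mulVec_zero h0 hsum hm hd0 hd1 hd (f := f - (d ⬝ᵥ f) • 1)
    (by rw [dotProduct_sub, dotProduct_smul, hone, smul_eq_mul, mul_one, sub_self])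
  have h2 := h.add_const ((d ⬝ᵥ f) • (1 : S → ℝ))
  simp only [mulVec_sub, mulVec_smul, pow_mulVec_one hsum, sub_add_cancel, zero_add] at h2
  convert h2 using 2
  funext s
  simp

/-- The Poisson equation of a stochastic matrix with a positive power is solvable. -/
theorem exists_poisson [Nonempty S] (h0 : ∀ i j, 0 ≤ P i j) (hsum : P *ᵥ 1 = 1) {m : ℕ}
    (hm : ∀ i j, 0 < (P ^ m) i j) {d : S → ℝ} (hd0 : ∀ s, 0 ≤ d s) (hd1 : ∑ s, d s = 1)
    (hd : d ᵥ* P = d) (f : S → ℝ) :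
    ∃ V : S → ℝ, ∀ s, V s = f s - d ⬝ᵥ f + (P *ᵥ V) s := by
  have hone : d ⬝ᵥ (1 : S → ℝ) = 1 := by simpa [dotProduct] using hd1
  -- The rank-one term removes the constants from the kernel of `1 - P`. A kernel vector of `L` has
  -- mean zero and is fixed by `P`, hence vanishes by convergence of the powers; in finite dimension
  -- `L` is then onto.
  let L : (S → ℝ) →ₗ[ℝ] (S → ℝ) :=
    LinearMap.id - Matrix.toLin' P + Matrix.toLin' (vecMulVec 1 d)
  have hL (v : S → ℝ) : L v = v - P *ᵥ v + (d ⬝ᵥ v) • 1 := by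
    funext i
    simp [L, mulVec, dotProduct]
  have hdL (v : S → ℝ) : d ⬝ᵥ L v = d ⬝ᵥ v := by
    rw [hL, dotProduct_add, dotProduct_sub, dotProduct_mulVec, hd, dotProduct_smul, hone]
    simp
  have hinj : Function.Injective L := by
    rw [← LinearMap.ker_eq_bot, LinearMap.ker_eq_bot']
    intro v hv
    have h1 : d ⬝ᵥ v = 0 := by rw [← hdL, hv, dotProduct_zero]
    rw [hL, h1, zero_smul, add_zero, sub_eq_zero] at hv
    have hfix (n : ℕ) : P ^ n *ᵥ v = v := by
      induction n with
      | zero => simp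
      | succ n ih => rw [pow_succ, ← mulVec_mulVec, ← hv, ih]
    have := tendsto_pow_mulVec_zero h0 hsum hm hd0 hd1 hd h1
    simp only [hfix] at this
    exact tendsto_nhds_unique tendsto_const_nhds this
  obtain ⟨V, hV⟩ := (LinearMap.injective_iff_surjective.1 hinj) (f - (d ⬝ᵥ f) • 1)
  have h1 : d ⬝ᵥ V = 0 := by
    rw [← hdL, hV, dotProduct_sub, dotProduct_smul, hone, smul_eq_mul, mul_one, sub_self]
  rw [hL, h1, zero_smul, add_zero] at hV
  refine ⟨V, fun s => ?_⟩
  have := congrFun hV s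
  simp only [Pi.sub_apply, Pi.smul_apply, Pi.one_apply, smul_eq_mul, mul_one] at this
  linarith

/-- Each summand equals `(P ^ k *ᵥ V) s - (P ^ (k + 1) *ᵥ V) s`, so the sum telescopes. -/
theorem tendsto_sum_pow_mulVec [Nonempty S] (h0 : ∀ i j, 0 ≤ P i j) (hsum : P *ᵥ 1 = 1) {m : ℕ}
    (hm : ∀ i j, 0 < (P ^ m) i j) {d : S → ℝ} (hd0 : ∀ s, 0 ≤ d s) (hd1 : ∑ s, d s = 1)
    (hd : d ᵥ* P = d) {f V : S → ℝ} (hV : ∀ s, V s = f s - d ⬝ᵥ f + (P *ᵥ V) s) (s : S) :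
    Tendsto (fun n : ℕ => ∑ k ∈ Finset.range n, ((P ^ k *ᵥ f) s - d ⬝ᵥ f)) atTop
      (𝓝 (V s - d ⬝ᵥ V)) := by
  have hstep (k : ℕ) : (P ^ k *ᵥ f) s - d ⬝ᵥ f = (P ^ k *ᵥ V) s - (P ^ (k + 1) *ᵥ V) s := by
    have hf : f = V - P *ᵥ V + (d ⬝ᵥ f) • 1 := by
      funext s
      have := hV s
      simp only [Pi.add_apply, Pi.sub_apply, Pi.smul_apply, Pi.one_apply, smul_eq_mul, mul_one]
      linarith
    rw [pow_succ, ← mulVec_mulVec]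
    conv_lhs => rw [hf]
    conv_lhs => enter [1]; rw [mulVec_add, mulVec_sub, mulVec_smul, pow_mulVec_one hsum]
    rw [← hf]
    simp
  simp_rw [hstep, Finset.sum_range_sub']
  simp only [pow_zero, one_mulVec]
  exact tendsto_const_nhds.sub
    (tendsto_pi_nhds.1 (tendsto_pow_mulVec h0 hsum hm hd0 hd1 hd V) s)

end StochasticMatrix

noncomputable section

/-! ### Policies, mean rewards and transition matrices -/

namespace IsPolicy

variable {X S : Type*} [MeasurableSpace X] {π : X → S → ℝ}

theorem ae_norm_le (hπ : IsPolicy π) (μ : Measure X) (s : S) : ∀ᵐ x ∂μ, ‖π x s‖ ≤ 1 :=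
  ae_of_all _ fun x => by
    rw [Real.norm_of_nonneg (hπ.nonneg x s)]
    exact hπ.le_one x s

theorem integrable (hπ : IsPolicy π) (μ : Measure X) [IsFiniteMeasure μ] (s : S) :
    Integrable (fun x => π x s) μ :=
  Integrable.of_bound (hπ.measurable s).aestronglyMeasurable 1 (hπ.ae_norm_le μ s)

theorem integrable_mul (hπ : IsPolicy π) {μ : Measure X} {f : X → ℝ} (hf : Integrable f μ)
    (s : S) : Integrable (fun x => π x s * f x) μ :=
  hf.bdd_mul (hπ.measurable s).aestronglyMeasurable (hπ.ae_norm_le μ s)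

theorem integrable_one_sub_mul (hπ : IsPolicy π) {μ : Measure X} {f : X → ℝ}
    (hf : Integrable f μ) (s : S) : Integrable (fun x => (1 - π x s) * f x) μ := by
  simpa only [sub_mul, one_mul] using! hf.sub (hπ.integrable_mul hf s)

end IsPolicy

namespace MDP

variable {X S : Type*} [MeasurableSpace X] [MeasurableSpace S] {M : MDP X S}

theorem measurable_meanOutcome (M : MDP X S) (s : S) (w : Bool) :
    Measurable fun x => M.meanOutcome x s w := by
  have h : StronglyMeasurable fun p => ∫ y, y ∂M.PY p :=
    StronglyMeasurable.integral_kernel stronglyMeasurable_id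
  exact h.measurable.comp (by fun_prop : Measurable fun x : X => (x, s, w))

theorem BoundedOutcomes.integrable_meanOutcome (hM : M.BoundedOutcomes) (s : S) (w : Bool) :
    Integrable (fun x => M.meanOutcome x s w) M.covLaw := by
  obtain ⟨B, hB⟩ := hM
  refine Integrable.of_bound (M.measurable_meanOutcome s w).aestronglyMeasurable B ?_
  filter_upwards [hB] with x hx
  simpa [meanOutcome] using norm_integral_le_of_norm_le_const (f := fun y : ℝ => y) (hx s w)

theorem BoundedOutcomes.integrable_cade (hM : M.BoundedOutcomes) (s : S) :
    Integrable (fun x => M.cade x s) M.covLaw :=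
  (hM.integrable_meanOutcome s true).sub (hM.integrable_meanOutcome s false)

/-- The expected outcome of a unit that arrives in state `s`. -/
def meanReward (M : MDP X S) (π : X → S → ℝ) (s : S) : ℝ :=
  ∫ x, (π x s * M.meanOutcome x s true + (1 - π x s) * M.meanOutcome x s false) ∂M.covLaw

theorem BoundedOutcomes.integrable_reward (hM : M.BoundedOutcomes) {π : X → S → ℝ}
    (hπ : IsPolicy π) (s : S) : Integrable (fun x => π x s * M.meanOutcome x s true
      + (1 - π x s) * M.meanOutcome x s false) M.covLaw :=
  (hπ.integrable_mul (hM.integrable_meanOutcome s true) s).add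
    (hπ.integrable_one_sub_mul (hM.integrable_meanOutcome s false) s)

theorem meanReward_sub (hM : M.BoundedOutcomes) {π π' : X → S → ℝ} (hπ : IsPolicy π)
    (hπ' : IsPolicy π') (s : S) :
    M.meanReward π' s - M.meanReward π s = ∫ x, (π' x s - π x s) * M.cade x s ∂M.covLaw := by
  rw [meanReward, meanReward, ← integral_sub (hM.integrable_reward hπ' s)
    (hM.integrable_reward hπ s)]
  refine integral_congr_ae (ae_of_all _ fun x => ?_)
  simp only [cade]
  ring

theorem transMatrix_nonneg (M : MDP X S) {π : X → S → ℝ} (hπ : IsPolicy π) (s s' : S) :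
    0 ≤ M.transMatrix π s s' :=
  integral_nonneg fun x => add_nonneg (mul_nonneg (hπ.nonneg x s) ENNReal.toReal_nonneg)
    (mul_nonneg (sub_nonneg.2 (hπ.le_one x s)) ENNReal.toReal_nonneg)

theorem transMatrix_apply (M : MDP X S) {π : X → S → ℝ} (hπ : IsPolicy π) (s s' : S) :
    M.transMatrix π s s' = (∫ x, π x s ∂M.covLaw) * (M.PS s true s').toReal
      + (1 - ∫ x, π x s ∂M.covLaw) * (M.PS s false s').toReal := by
  have h := hπ.integrable M.covLaw s
  have h' : Integrable (fun x => 1 - π x s) M.covLaw := (integrable_const 1).sub h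
  rw [transMatrix, Matrix.of_apply, integral_add (h.mul_const _) (h'.mul_const _),
    integral_mul_const, integral_mul_const,
    integral_sub (integrable_const 1) h]
  simp

variable [Fintype S]

theorem sum_toReal_PS (M : MDP X S) (s : S) (w : Bool) : ∑ s', (M.PS s w s').toReal = 1 := by
  rw [← ENNReal.toReal_sum fun s' _ => (M.PS s w).apply_ne_top s',
    ← tsum_fintype (L := .unconditional S),
    (M.PS s w).tsum_coe, ENNReal.toReal_one]

theorem transMatrix_mulVec_one (M : MDP X S) {π : X → S → ℝ} (hπ : IsPolicy π) :
    (M.transMatrix π).mulVec 1 = 1 := by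
  funext s
  simp only [Matrix.mulVec, dotProduct, Pi.one_apply, mul_one, M.transMatrix_apply hπ,
    Finset.sum_add_distrib, ← Finset.mul_sum, sum_toReal_PS]
  ring

theorem isStationary_iff {π : X → S → ℝ} {d : S → ℝ} :
    M.IsStationary π d ↔
      (∀ s, 0 ≤ d s) ∧ ∑ s, d s = 1 ∧ Matrix.vecMul d (M.transMatrix π) = d :=
  ⟨fun h => ⟨h.nonneg, h.sum_eq_one, funext h.invariant⟩,
    fun h => ⟨h.1, h.2.1, fun s => congrFun h.2.2 s⟩⟩

/-- The effect of the treatment in state `s` on the expected value of `V` in the next state. -/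
def indirectEffect (M : MDP X S) (V : S → ℝ) (s : S) : ℝ :=
  ∑ s', (M.PS s true s').toReal * V s' - ∑ s', (M.PS s false s').toReal * V s'

/-- The next state does not depend on the covariate, so a policy enters the transitions only through
its mean treatment probability in each state. -/
theorem transMatrix_sub_mulVec (M : MDP X S) {π π' : X → S → ℝ} (hπ : IsPolicy π)
    (hπ' : IsPolicy π') (V : S → ℝ) (s : S) :
    ((M.transMatrix π' - M.transMatrix π).mulVec V) s =
      (∫ x, (π' x s - π x s) ∂M.covLaw) * M.indirectEffect V s := by
  rw [integral_sub (hπ'.integrable _ s) (hπ.integrable _ s), indirectEffect,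
    ← Finset.sum_sub_distrib, Finset.mul_sum]
  refine Finset.sum_congr rfl fun s' _ => ?_
  change (M.transMatrix π' s s' - M.transMatrix π s s') * V s' = _
  rw [M.transMatrix_apply hπ, M.transMatrix_apply hπ']
  ring

/-! ### Performance difference and uniqueness of the gradient -/

variable {π π' : X → S → ℝ}

theorem avgOutcome_eq (hM : M.BoundedOutcomes) (hπ : IsPolicy π) :
    M.avgOutcome π = M.statDist π ⬝ᵥ M.meanReward π := by
  rw [avgOutcome, integral_finsetSum]
  · simp_rw [integral_const_mul]
    rfl
  · exact fun s _ => (hM.integrable_reward hπ s).const_mul _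

/-- `V` solves the Poisson equation of the state process under `π` with the reward `f`. -/
def IsPoisson (M : MDP X S) (π : X → S → ℝ) (f V : S → ℝ) : Prop :=
  ∀ s, V s = f s - M.statDist π ⬝ᵥ f + ((M.transMatrix π).mulVec V) s

/-- The rewards are left general because two choices are needed: mean rewards for the performance
difference, and a fixed indicator for the continuity of `statDist`. -/
theorem dotProduct_statDist_sub (hπ : IsPolicy π) (hπ' : IsPolicy π')
    (hstat : M.IsStationary π' (M.statDist π')) {f f' V : S → ℝ} (hV : M.IsPoisson π f V) :
    M.statDist π' ⬝ᵥ f' - M.statDist π ⬝ᵥ f = ∑ s, M.statDist π' s *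
      (f' s - f s + (∫ x, (π' x s - π x s) ∂M.covLaw) * M.indirectEffect V s) := by
  have hd := isStationary_iff.1 hstat
  rw [dotProduct_sub_of_poisson hd.2.1 hd.2.2 hV]
  refine Finset.sum_congr rfl fun s _ => ?_
  rw [Pi.add_apply, Pi.sub_apply, M.transMatrix_sub_mulVec hπ hπ']

/-- The performance difference formula. -/
theorem avgOutcome_sub (hM : M.BoundedOutcomes) (hπ : IsPolicy π) (hπ' : IsPolicy π')
    (hstat : M.IsStationary π' (M.statDist π')) {V : S → ℝ}
    (hV : M.IsPoisson π (M.meanReward π) V) :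
    M.avgOutcome π' - M.avgOutcome π = ∑ s, M.statDist π' s *
      ∫ x, (π' x s - π x s) * (M.cade x s + M.indirectEffect V s) ∂M.covLaw := by
  rw [avgOutcome_eq hM hπ, avgOutcome_eq hM hπ', dotProduct_statDist_sub hπ hπ' hstat hV]
  refine Finset.sum_congr rfl fun s _ => ?_
  have hint : Integrable (fun x => π' x s - π x s) M.covLaw :=
    (hπ'.integrable M.covLaw s).sub (hπ.integrable M.covLaw s)
  have hint2 : Integrable (fun x => (π' x s - π x s) * M.cade x s) M.covLaw := by
    simpa only [sub_mul] using! (hπ'.integrable_mul (hM.integrable_cade s) s).sub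
      (hπ.integrable_mul (hM.integrable_cade s) s)
  simp_rw [mul_add]
  rw [integral_add hint2 (hint.mul_const _), meanReward_sub hM hπ hπ', integral_mul_const]
  ring

/-- The gradient is unique up to null sets of the reference measure. -/
theorem HasPolicyGradient.ae_eq [DecidableEq S] {G G' : X → S → ℝ} (hπ : IsPolicy π)
    (hG : M.HasPolicyGradient π G) (hG' : M.HasPolicyGradient π G') (s : S) :
    (fun x => G x s) =ᵐ[M.ν] fun x => G' x s := by
  -- A perturbation along `σ` moves away from the nearer endpoint of the unit interval, so it
  -- remains a policy for all `t` in `[0, 1/2]`, even where `π` is 0 or 1.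
  let σ : X → ℝ := fun x => if π x s ≤ 1 / 2 then 1 else -1
  have hσ : Measurable σ :=
    Measurable.ite (measurableSet_le (hπ.measurable s) measurable_const)
      measurable_const measurable_const
  have hσ2 (x : X) : σ x ≠ 0 := by
    simp only [σ]; split_ifs <;> norm_num
  have hσ1 : ∀ᵐ x ∂M.ν, ‖σ x‖ ≤ 1 := ae_of_all _ fun x => by
    simp only [σ]; split_ifs <;> norm_num
  have hint : Integrable (fun x => σ x * (G x s - G' x s)) M.ν :=
    ((hG.1 s).sub (hG'.1 s)).bdd_mul hσ.aestronglyMeasurable hσ1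
  have hzero : (fun x => σ x * (G x s - G' x s)) =ᵐ[M.ν] 0 := by
    refine hint.ae_eq_zero_of_forall_setIntegral_eq_zero fun A hA _ => ?_
    let h : X → S → ℝ := fun x s' => if s' = s then A.indicator σ x else 0
    have hh (s' : S) : Measurable fun x => h x s' := by
      by_cases hs : s' = s
      · simpa [h, hs] using hσ.indicator hA
      · simp [h, hs]
    have hT : Set.Icc (0 : ℝ) (1 / 2) ⊆ {t : ℝ | IsPolicy fun x s => π x s + t * h x s} := by
      intro t ht
      have hbd (x : X) (s' : S) : 0 ≤ π x s' + t * h x s' ∧ π x s' + t * h x s' ≤ 1 := by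
        have h0 := hπ.nonneg x s'
        have h1 := hπ.le_one x s'
        by_cases hs : s' = s
        · subst hs
          by_cases hx : x ∈ A
          · by_cases hp : π x s' ≤ 1 / 2
            · simp only [h, if_true, Set.indicator_of_mem hx, σ, if_pos hp]
              constructor <;> linarith [ht.1, ht.2]
            · simp only [h, if_true, Set.indicator_of_mem hx, σ, if_neg hp]
              constructor <;> linarith [ht.1, ht.2]
          · simpa [h, hx] using ⟨h0, h1⟩
        · simpa [h, hs] using ⟨h0, h1⟩
      exact ⟨fun s' => (hπ.measurable s').add ((hh s').const_mul t), fun x s' => (hbd x s').1,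
        fun x s' => (hbd x s').2⟩
    have huniq : UniqueDiffWithinAt ℝ (Set.Icc (0 : ℝ) (1 / 2)) 0 :=
      uniqueDiffOn_Icc (by norm_num) 0 (by norm_num)
    have heq := huniq.eq_deriv _ ((hG.2 h hh).mono hT) ((hG'.2 h hh).mono hT)
    have hform (G : X → S → ℝ) :
        ∫ x, ∑ s', G x s' * h x s' ∂M.ν = ∫ x in A, σ x * G x s ∂M.ν := by
      rw [← integral_indicator hA]
      refine integral_congr_ae (ae_of_all _ fun x => ?_)
      by_cases hx : x ∈ A <;> simp [h, hx, mul_comm]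
    rw [hform, hform] at heq
    simp_rw [mul_sub]
    rw [integral_sub, heq, sub_self]
    · exact ((hG.1 s).bdd_mul hσ.aestronglyMeasurable hσ1).integrableOn
    · exact ((hG'.1 s).bdd_mul hσ.aestronglyMeasurable hσ1).integrableOn
  filter_upwards [hzero] with x hx
  exact sub_eq_zero.1 ((mul_eq_zero.1 hx).resolve_left (hσ2 x))

/-! ### Stationary distributions and directional derivatives -/

section Ergodic

variable [DecidableEq S] [Nonempty S]

/-- Powers of the matrix applied to the indicator of `s` converge to the mass at `s` of any
stationary distribution. This forces uniqueness, so the chosen `statDist` is the positive one. -/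
theorem statDist_spec (hπ : IsPolicy π) (hirr : (M.transMatrix π).IsIrreducible)
    (haper : IsAperiodic (M.transMatrix π)) :
    M.IsStationary π (M.statDist π) ∧ (∀ d, M.IsStationary π d → d = M.statDist π) ∧
      ∀ s, 0 < M.statDist π s := by
  obtain ⟨m, hm⟩ := exists_pow_pos hirr haper
  obtain ⟨d₀, hpos, hsum, hinv⟩ :=
    exists_stationary (M.transMatrix_nonneg hπ) (M.transMatrix_mulVec_one hπ) hm
  have hd₀ : M.IsStationary π d₀ := isStationary_iff.2 ⟨fun s => (hpos s).le, hsum, hinv⟩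
  have huniq (d d' : S → ℝ) (hd : M.IsStationary π d) (hd' : M.IsStationary π d') : d = d' := by
    rw [isStationary_iff] at hd hd'
    funext s
    have h (d : S → ℝ) (hd : (∀ s, 0 ≤ d s) ∧ ∑ s, d s = 1 ∧
        Matrix.vecMul d (M.transMatrix π) = d) :=
      tendsto_pow_mulVec (M.transMatrix_nonneg hπ) (M.transMatrix_mulVec_one hπ) hm hd.1 hd.2.1
        hd.2.2 (Pi.single s 1)
    simpa using congrFun (tendsto_nhds_unique (h d hd) (h d' hd')) s
  have hex : ∃ d, M.IsStationary π d := ⟨d₀, hd₀⟩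
  have hstat : M.IsStationary π (M.statDist π) := by
    rw [statDist, dif_pos hex]
    exact hex.choose_spec
  exact ⟨hstat, fun d hd => huniq _ _ hd hstat, fun s => huniq _ _ hd₀ hstat ▸ hpos s⟩

theorem exists_isPoisson (hπ : IsPolicy π) (hirr : (M.transMatrix π).IsIrreducible)
    (haper : IsAperiodic (M.transMatrix π)) (f : S → ℝ) : ∃ V, M.IsPoisson π f V := by
  obtain ⟨m, hm⟩ := exists_pow_pos hirr haper
  have hd := isStationary_iff.1 (statDist_spec hπ hirr haper).1
  exact exists_poisson (M.transMatrix_nonneg hπ) (M.transMatrix_mulVec_one hπ) hm hd.1 hd.2.1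
    hd.2.2 f

/-- The stationary distribution is Lipschitz in the policy. -/
theorem abs_statDist_sub_le (hπ : IsPolicy π) (hirr : (M.transMatrix π).IsIrreducible)
    (haper : IsAperiodic (M.transMatrix π)) (s : S) :
    ∃ K : ℝ, 0 ≤ K ∧ ∀ π', IsPolicy π' → M.IsStationary π' (M.statDist π') →
      |M.statDist π' s - M.statDist π s| ≤
        K * ∑ s', |∫ x, (π' x s' - π x s') ∂M.covLaw| := by
  obtain ⟨V, hV⟩ := exists_isPoisson hπ hirr haper (Pi.single s 1)
  refine ⟨∑ s', |M.indirectEffect V s'|, Finset.sum_nonneg fun _ _ => abs_nonneg _,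
    fun π' hπ' hstat => ?_⟩
  have h := dotProduct_statDist_sub hπ hπ' hstat (f' := Pi.single s 1) hV
  simp only [dotProduct_single_one, sub_self, zero_add] at h
  rw [h, Finset.mul_sum]
  refine (Finset.abs_sum_le_sum_abs _ _).trans (Finset.sum_le_sum fun s' _ => ?_)
  have hle : M.statDist π' s' ≤ 1 :=
    hstat.sum_eq_one ▸ Finset.single_le_sum (fun i _ => hstat.nonneg i) (Finset.mem_univ s')
  rw [abs_mul, abs_mul, abs_of_nonneg (hstat.nonneg s'),
    mul_comm (∑ s', |M.indirectEffect V s'|)]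
  refine (mul_le_of_le_one_left (by positivity) hle).trans ?_
  exact mul_le_mul_of_nonneg_left (Finset.single_le_sum
    (f := fun s' => |M.indirectEffect V s'|) (fun _ _ => abs_nonneg _) (Finset.mem_univ s'))
    (abs_nonneg _)

/-- The directional derivative of the average outcome. -/
theorem hasDerivWithinAt_avgOutcome (hM : M.BoundedOutcomes)
    (hirr : ∀ π : Policy X S, (M.transMatrix π.1).IsIrreducible)
    (haper : ∀ π : Policy X S, IsAperiodic (M.transMatrix π.1)) (hπ : IsPolicy π) {V : S → ℝ}
    (hV : M.IsPoisson π (M.meanReward π) V) {h : X → S → ℝ} (hh : ∀ s, Measurable fun x => h x s) :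
    HasDerivWithinAt (fun t : ℝ => M.avgOutcome fun x s => π x s + t * h x s)
      (∫ x, ∑ s, M.statDist π s * (M.cade x s + M.indirectEffect V s) * h x s ∂M.covLaw)
      {t : ℝ | IsPolicy fun x s => π x s + t * h x s} 0 := by
  set T := {t : ℝ | IsPolicy fun x s => π x s + t * h x s} with hT
  set D : S → ℝ := fun s => ∫ x, h x s * (M.cade x s + M.indirectEffect V s) ∂M.covLaw
  have hstat {t : ℝ} (ht : t ∈ T) := (statDist_spec ht (hirr ⟨_, ht⟩) (haper ⟨_, ht⟩)).1
  by_cases hne : ∃ t ∈ T, t ≠ 0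
  · obtain ⟨t₁, ht₁, ht₁0⟩ := hne
    -- A single admissible `t₁ ≠ 0` bounds `h`, since `t₁ * h` is a difference of two functions with
    -- values in `[0, 1]`. This supplies the integrability.
    have hbd (x : X) (s : S) : ‖h x s‖ ≤ |t₁|⁻¹ := by
      have h1 := ht₁.nonneg x s
      have h2 := ht₁.le_one x s
      have h3 := hπ.nonneg x s
      have h4 := hπ.le_one x s
      rw [← one_div, le_div_iff₀ (abs_pos.2 ht₁0), Real.norm_eq_abs, ← abs_mul, abs_le]
      constructor <;> nlinarith
    have hI (s : S) : Integrable (fun x => h x s * (M.cade x s + M.indirectEffect V s))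
        M.covLaw :=
      ((hM.integrable_cade s).add (integrable_const _)).bdd_mul (hh s).aestronglyMeasurable
        (ae_of_all _ fun x => hbd x s)
    have hlim : ∫ x, ∑ s, M.statDist π s * (M.cade x s + M.indirectEffect V s) * h x s
        ∂M.covLaw = ∑ s, M.statDist π s * D s := by
      simp_rw [mul_assoc, mul_comm (M.cade _ _ + _)]
      rw [integral_finsetSum _ fun s _ => (hI s).const_mul _]
      simp_rw [integral_const_mul]
      rfl
    rw [hlim, hasDerivWithinAt_iff_tendsto_slope]
    -- The difference quotient is exact, with no remainder term; only the weights `statDist` vary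
    -- with `t`.
    have hslope : ∀ᶠ t in 𝓝[T \ {0}] 0,
        ∑ s, M.statDist (fun x s => π x s + t * h x s) s * D s =
          slope (fun t : ℝ => M.avgOutcome fun x s => π x s + t * h x s) 0 t := by
      filter_upwards [self_mem_nhdsWithin] with t ht
      have hsub := avgOutcome_sub hM hπ ht.1 (hstat ht.1) hV
      simp only [add_sub_cancel_left, mul_assoc, integral_const_mul] at hsub
      rw [slope_def_field]
      simp only [zero_mul, add_zero, sub_zero]
      rw [hsub, eq_div_iff ht.2, Finset.sum_mul]
      exact Finset.sum_congr rfl fun s _ => by ring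
    refine Tendsto.congr' hslope (tendsto_finsetSum _ fun s _ => Tendsto.mul_const _ ?_)
    obtain ⟨K, -, hK⟩ := abs_statDist_sub_le hπ (hirr ⟨π, hπ⟩) (haper ⟨π, hπ⟩) s
    rw [tendsto_iff_dist_tendsto_zero]
    have hz : Tendsto (fun t : ℝ => K * ∑ s', |t * ∫ x, h x s' ∂M.covLaw|) (𝓝[T \ {0}] 0)
        (𝓝 0) := by
      have hc : Continuous fun t : ℝ => K * ∑ s', |t * ∫ x, h x s' ∂M.covLaw| := by fun_prop
      simpa using (hc.tendsto 0).mono_left nhdsWithin_le_nhds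
    refine squeeze_zero' (Eventually.of_forall fun _ => dist_nonneg) ?_ hz
    filter_upwards [self_mem_nhdsWithin] with t ht
    simpa only [Real.dist_eq, add_sub_cancel_left, integral_const_mul] using
      hK _ ht.1 (hstat ht.1)
  -- Here `T` contains at most the point 0, so any value is a derivative within `T`.
  · push Not at hne
    exact HasFDerivWithinAt.of_subsingleton fun a ha b hb => (hne a ha).trans (hne b hb).symm

end Ergodic

end MDP

/-! ### Path laws and their marginals -/

namespace MDP

variable {X S : Type*} [MeasurableSpace X] [MeasurableSpace S] [Countable S]
  [MeasurableSingletonClass S] {M : MDP X S} {π : Policy X S}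

section Paths

variable {init : Measure (Obs X S)}

theorem traj_preimage_zero (z : Obs X S) {A : Set (Obs X S)} (hA : MeasurableSet A) :
    Kernel.traj (X := fun _ => Obs X S) (M.historyKernel π) 0
        ((MeasurableEquiv.piUnique fun _ : Finset.Iic 0 => Obs X S).symm z)
        ((fun ω => ω 0) ⁻¹' A) = A.indicator 1 z := by
  have h := Kernel.traj_map_frestrictLe_of_le (X := fun _ => Obs X S) (κ := M.historyKernel π)
    (le_refl 0)
  have h2 := DFunLike.congr_fun h
    ((MeasurableEquiv.piUnique fun _ : Finset.Iic 0 => Obs X S).symm z)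
  rw [Kernel.map_apply _ (by fun_prop), Kernel.deterministic_apply] at h2
  have hev : Measurable fun x : (_ : Finset.Iic 0) → Obs X S => x ⟨0, Finset.mem_Iic.2 le_rfl⟩ :=
    measurable_pi_apply _
  have h3 := congrArg (fun μ => μ ((fun x => x ⟨0, Finset.mem_Iic.2 le_rfl⟩) ⁻¹' A)) h2
  rw [Measure.map_apply (by fun_prop) (hev hA), Measure.dirac_apply' _ (hev hA)] at h3
  exact h3

theorem traj_preimage_zero_inter (z : Obs X S) {A : Set (Obs X S)} (hA : MeasurableSet A)
    (B : Set (ℕ → Obs X S)) :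
    Kernel.traj (X := fun _ => Obs X S) (M.historyKernel π) 0
        ((MeasurableEquiv.piUnique fun _ : Finset.Iic 0 => Obs X S).symm z)
        ((fun ω => ω 0) ⁻¹' A ∩ B) =
      A.indicator (fun z => Kernel.traj (X := fun _ => Obs X S) (M.historyKernel π) 0
        ((MeasurableEquiv.piUnique fun _ : Finset.Iic 0 => Obs X S).symm z) B) z := by
  by_cases hz : z ∈ A
  · rw [Set.indicator_of_mem hz, Set.inter_comm]
    refine measure_inter_conull ?_
    rw [← Set.preimage_compl, traj_preimage_zero z hA.compl, Set.indicator_of_notMem]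
    simpa using hz
  · rw [Set.indicator_of_notMem hz]
    refine measure_inter_null_of_null_left _ ?_
    rw [traj_preimage_zero z hA, Set.indicator_of_notMem hz]

theorem pathLaw_apply {B : Set (ℕ → Obs X S)} (hB : MeasurableSet B) :
    M.pathLaw π init B = ∫⁻ z, Kernel.traj (X := fun _ => Obs X S) (M.historyKernel π) 0
      ((MeasurableEquiv.piUnique fun _ : Finset.Iic 0 => Obs X S).symm z) B ∂init := by
  rw [pathLaw, Kernel.trajMeasure, Measure.bind_apply hB (Kernel.aemeasurable _),
    lintegral_map (Kernel.measurable_coe _ hB) (MeasurableEquiv.measurable _)]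

theorem pathLaw_map_zero : (M.pathLaw π init).map (fun ω => ω 0) = init := by
  ext A hA
  have hev : Measurable fun ω : ℕ → Obs X S => ω 0 := measurable_pi_apply 0
  rw [Measure.map_apply hev hA, pathLaw_apply (hev hA)]
  simp_rw [traj_preimage_zero _ hA]
  rw [lintegral_indicator_one hA]

/-- A trajectory started from a record keeps it at coordinate 0, so an event about that coordinate
can be moved into the initial law. -/
theorem cond_pathLaw {A : Set (Obs X S)} (hA : MeasurableSet A) :
    ProbabilityTheory.cond (M.pathLaw π init) ((fun ω => ω 0) ⁻¹' A) =
      M.pathLaw π (ProbabilityTheory.cond init A) := by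
  have hev : Measurable fun ω : ℕ → Obs X S => ω 0 := measurable_pi_apply 0
  ext B hB
  rw [cond_apply (hev hA), pathLaw_apply ((hev hA).inter hB), pathLaw_apply hB,
    ← Measure.map_apply hev hA, pathLaw_map_zero, ProbabilityTheory.cond, lintegral_smul_measure]
  simp_rw [traj_preimage_zero_inter _ hA]
  rw [lintegral_indicator hA, smul_eq_mul]

variable [IsProbabilityMeasure init]

instance : IsProbabilityMeasure (M.pathLaw π init) := by
  unfold pathLaw
  infer_instance

/-- The history kernel reads only the last record, so the joint law of history and next record
yields a recursion for the one-time marginals. -/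
theorem pathLaw_map_succ (n : ℕ) :
    (M.pathLaw π init).map (fun ω => ω (n + 1)) =
      M.stepKernel π ∘ₘ (M.pathLaw π init).map (fun ω => ω n) := by
  have h := Kernel.map_frestrictLe_trajMeasure_compProd_eq_map_trajMeasure
    (X := fun _ => Obs X S) (κ := M.historyKernel π) (μ₀ := init) (a := n)
  have h2 := congrArg Measure.snd h
  rw [Measure.snd_compProd, Measure.snd, Measure.map_map measurable_snd (by fun_prop)] at h2
  refine h2.symm.trans ?_
  have hev : Measurable fun x : (_ : Finset.Iic n) → Obs X S => x ⟨n, Finset.mem_Iic.2 le_rfl⟩ :=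
    measurable_pi_apply _
  have h3 : (M.pathLaw π init).map (fun ω => ω n) =
      ((M.pathLaw π init).map (Preorder.frestrictLe n)).map
        (fun x => x ⟨n, Finset.mem_Iic.2 le_rfl⟩) := by
    rw [Measure.map_map hev (by fun_prop)]
    rfl
  rw [h3, ← Measure.deterministic_comp_eq_map hev, Measure.comp_assoc,
    Kernel.comp_deterministic_eq_comap]
  rfl

end Paths

/-! ### Integration against the law of one unit -/

section UnitKernel

theorem unitKernel_apply (s : S) : M.unitKernel π s =
    (((Kernel.const S M.covLaw ⊗ₖ treatKernel π) ⊗ₖ M.outcomeKernel) s).map (Prod.mk s) := by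
  rw [unitKernel, Kernel.prod_apply, Kernel.id_apply, Measure.dirac_prod]

theorem ae_unitKernel {p : Obs X S → Prop} (hp : MeasurableSet {z | p z}) {s : S}
    (h : ∀ᵐ x ∂M.covLaw, ∀ᵐ w ∂treatKernel π (s, x), ∀ᵐ y ∂M.PY (x, s, w), p (s, (x, w), y)) :
    ∀ᵐ z ∂M.unitKernel π s, p z := by
  have hm : Measurable (Prod.mk s : (X × Bool) × ℝ → Obs X S) := measurable_prodMk_left
  rw [unitKernel_apply, ae_map_iff hm.aemeasurable hp]
  have hp' : MeasurableSet {q : (X × Bool) × ℝ | p (s, q)} := hm hp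
  have hin : MeasurableSet {q : X × Bool | ∀ᵐ y ∂M.outcomeKernel (s, q), p (s, q, y)} := by
    have := Kernel.measurable_kernel_prodMk_left' (η := M.outcomeKernel) hp'.compl s
    exact this (measurableSet_singleton 0)
  rw [Kernel.ae_compProd_iff hp', Kernel.ae_compProd_iff hin]
  simpa [outcomeKernel] using h

theorem ae_unitKernel_fst (s : S) : ∀ᵐ z ∂M.unitKernel π s, z.1 = s :=
  ae_unitKernel (measurableSet_eq_fun measurable_fst measurable_const)
    (ae_of_all _ fun _ => ae_of_all _ fun _ => ae_of_all _ fun _ => rfl)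

theorem ae_unitKernel_const_treatment (s : S) (w : Bool) :
    ∀ᵐ z ∂M.unitKernel (Policy.const X S w) s, z.2.1.2 = w := by
  refine ae_unitKernel (measurableSet_eq_fun (by fun_prop) measurable_const)
    (ae_of_all _ fun x => ?_)
  have h : treatKernel (Policy.const X S w) (s, x) = Measure.dirac w := by
    change (ENNReal.ofReal (if w then 1 else 0) • Measure.dirac true
      + ENNReal.ofReal (1 - if w then 1 else 0) • Measure.dirac false : Measure Bool) = _
    cases w <;> simp
  rw [h, ae_dirac_eq]
  exact ae_of_all _ fun _ => rfl

theorem BoundedOutcomes.integrable_outcome (hM : M.BoundedOutcomes) (ρ : Measure S)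
    [IsFiniteMeasure ρ] : Integrable (fun z : Obs X S => z.2.2) (M.unitKernel π ∘ₘ ρ) := by
  obtain ⟨B, hB⟩ := hM
  have hp : MeasurableSet {z : Obs X S | ‖z.2.2‖ ≤ B} :=
    measurableSet_le (by fun_prop) measurable_const
  refine Integrable.of_bound (by fun_prop : Measurable fun z : Obs X S => z.2.2).aestronglyMeasurable
    B (Measure.ae_comp_of_ae_ae hp (ae_of_all _ fun s => ?_))
  refine ae_unitKernel hp ?_
  filter_upwards [hB] with x hx
  exact ae_of_all _ fun w => hx s w

theorem integral_treatKernel (p : S × X) (f : Bool → ℝ) :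
    ∫ w, f w ∂treatKernel π p = π.1 p.2 p.1 * f true + (1 - π.1 p.2 p.1) * f false := by
  change ∫ w, f w ∂(ENNReal.ofReal (π.1 p.2 p.1) • Measure.dirac true
    + ENNReal.ofReal (1 - π.1 p.2 p.1) • Measure.dirac false : Measure Bool) = _
  have hi (c : ℝ) (w : Bool) : Integrable f (ENNReal.ofReal c • Measure.dirac w) :=
    Integrable.smul_measure .of_finite ENNReal.ofReal_ne_top
  rw [integral_add_measure (hi _ _) (hi _ _), integral_smul_measure, integral_smul_measure,
    integral_dirac, integral_dirac, ENNReal.toReal_ofReal (π.2.nonneg _ _),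
    ENNReal.toReal_ofReal (sub_nonneg.2 (π.2.le_one _ _)), smul_eq_mul, smul_eq_mul]

theorem integral_unitKernel {s : S} {g : Obs X S → ℝ} (hg : Integrable g (M.unitKernel π s)) :
    ∫ z, g z ∂M.unitKernel π s =
      ∫ x, (π.1 x s * ∫ y, g (s, (x, true), y) ∂M.PY (x, s, true)
        + (1 - π.1 x s) * ∫ y, g (s, (x, false), y) ∂M.PY (x, s, false)) ∂M.covLaw := by
  have hm : Measurable (Prod.mk s : (X × Bool) × ℝ → Obs X S) := measurable_prodMk_left
  rw [unitKernel_apply] at hg ⊢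
  have hg' : Integrable (fun q => g (s, q))
      (((Kernel.const S M.covLaw ⊗ₖ treatKernel π) ⊗ₖ M.outcomeKernel) s) :=
    (integrable_map_measure hg.1 hm.aemeasurable).1 hg
  rw [integral_map hm.aemeasurable hg.1, integral_compProd hg',
    integral_compProd hg'.integral_compProd]
  simp only [integral_treatKernel, Kernel.const_apply]
  rfl

theorem BoundedOutcomes.integral_outcome (hM : M.BoundedOutcomes) (s : S) :
    ∫ z, z.2.2 ∂M.unitKernel π s = M.meanReward π.1 s := by
  have := hM.integrable_outcome (π := π) (Measure.dirac s)
  rw [Measure.dirac_bind (Kernel.measurable _)] at this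
  rw [integral_unitKernel this]
  rfl

end UnitKernel

/-! ### The state process and expected outcomes -/

theorem integral_comp_measure {α β : Type*} [MeasurableSpace α] [MeasurableSpace β]
    {κ : Kernel α β} {ρ : Measure α} {f : β → ℝ} (hf : Integrable f (κ ∘ₘ ρ)) :
    ∫ z, f z ∂(κ ∘ₘ ρ) = ∫ a, ∫ z, f z ∂κ a ∂ρ := by
  rw [Measure.comp_eq_comp_const_apply] at hf ⊢
  rw [Kernel.integral_comp hf, Kernel.const_apply]

/-- The kernel from the record of a unit to the state of the next unit. -/
def nextStateKernel (M : MDP X S) : Kernel (Obs X S) S :=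
  M.stateKernel.comap (fun z => (z.1, z.2.1.2)) (by fun_prop)

instance (M : MDP X S) : IsMarkovKernel M.nextStateKernel := by
  unfold nextStateKernel; infer_instance

/-- The transition kernel of the state process under `π`. -/
def transKernel (M : MDP X S) (π : Policy X S) : Kernel S S :=
  M.nextStateKernel ∘ₖ M.unitKernel π

instance (M : MDP X S) (π : Policy X S) : IsMarkovKernel (M.transKernel π) := by
  unfold transKernel; infer_instance

/-- The offset `k` is 0 when only the first state is given, and 1 when the first treatment is given
too, because that first record need not follow `π`. -/
theorem pathLaw_map_add {init : Measure (Obs X S)} [IsProbabilityMeasure init] {k : ℕ}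
    {ρ : Measure S} (h : (M.pathLaw π init).map (fun ω => ω k) = M.unitKernel π ∘ₘ ρ) (n : ℕ) :
    (M.pathLaw π init).map (fun ω => ω (k + n)) =
      M.unitKernel π ∘ₘ ((fun ρ => M.transKernel π ∘ₘ ρ)^[n] ρ) := by
  induction n with
  | zero => exact h
  | succ n ih =>
    rw [← add_assoc, pathLaw_map_succ, ih, Function.iterate_succ_apply', Measure.comp_assoc,
      Measure.comp_assoc, transKernel, ← Kernel.comp_assoc]
    rfl

variable {S : Type*} [MeasurableSpace S] [MeasurableSingletonClass S] [Fintype S]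
  {M : MDP X S} {π : Policy X S}

theorem integral_stateKernel (p : S × Bool) (g : S → ℝ) :
    ∫ s', g s' ∂M.stateKernel p = ∑ s', (M.PS p.1 p.2 s').toReal * g s' := by
  change ∫ s', g s' ∂(M.PS p.1 p.2).toMeasure = _
  rw [PMF.integral_eq_sum]
  rfl

theorem integral_transKernel (s : S) (g : S → ℝ) :
    ∫ s', g s' ∂M.transKernel π s = ((M.transMatrix π.1).mulVec g) s := by
  have hg : Integrable g (M.transKernel π s) := .of_finite
  rw [transKernel] at hg ⊢
  rw [Kernel.integral_comp hg, integral_unitKernel hg.integral_comp]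
  simp only [nextStateKernel, Kernel.comap_apply, integral_stateKernel, integral_const,
    probReal_univ, one_smul]
  have h1 := π.2.integrable M.covLaw s
  have h2 : Integrable (fun x => 1 - π.1 x s) M.covLaw := (integrable_const 1).sub h1
  rw [integral_add (h1.mul_const _) (h2.mul_const _), integral_mul_const, integral_mul_const,
    integral_sub (integrable_const 1) h1]
  simp only [Matrix.mulVec, dotProduct, M.transMatrix_apply π.2, integral_const, probReal_univ,
    one_smul, Finset.mul_sum, ← Finset.sum_add_distrib]
  exact Finset.sum_congr rfl fun s' _ => by ring

variable [DecidableEq S]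

theorem integral_iterate_transKernel (ρ : Measure S) [IsProbabilityMeasure ρ] (n : ℕ)
    (g : S → ℝ) : IsProbabilityMeasure ((fun ρ => M.transKernel π ∘ₘ ρ)^[n] ρ) ∧
      ∫ s, g s ∂((fun ρ => M.transKernel π ∘ₘ ρ)^[n] ρ) =
        ∫ s, ((M.transMatrix π.1 ^ n).mulVec g) s ∂ρ := by
  -- The step applies the hypothesis to the image of `g` under the transition matrix.
  induction n generalizing g with
  | zero => exact ⟨‹_›, by simp⟩
  | succ n ih =>
    have := (ih g).1
    rw [Function.iterate_succ_apply']
    refine ⟨inferInstance, ?_⟩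
    rw [integral_comp_measure .of_finite, pow_succ, ← Matrix.mulVec_mulVec, ← (ih _).2]
    simp_rw [integral_transKernel]

theorem BoundedOutcomes.integral_outcomeAt (hM : M.BoundedOutcomes) {init : Measure (Obs X S)}
    [IsProbabilityMeasure init] {k : ℕ} {ρ : Measure S} [IsProbabilityMeasure ρ]
    (h : (M.pathLaw π init).map (fun ω => ω k) = M.unitKernel π ∘ₘ ρ) (n : ℕ) :
    Integrable (outcomeAt (k + n)) (M.pathLaw π init) ∧
      ∫ ω, outcomeAt (k + n) ω ∂M.pathLaw π init =
        ∫ s, ((M.transMatrix π.1 ^ n).mulVec (M.meanReward π.1)) s ∂ρ := by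
  have hev : Measurable fun ω : ℕ → Obs X S => ω (k + n) := measurable_pi_apply _
  have hmeas : Measurable fun z : Obs X S => z.2.2 := by fun_prop
  obtain ⟨hprob, hint⟩ := integral_iterate_transKernel (M := M) (π := π) ρ n (M.meanReward π.1)
  have hY := hM.integrable_outcome (π := π) ((fun ρ => M.transKernel π ∘ₘ ρ)^[n] ρ)
  constructor
  · rw [← pathLaw_map_add h] at hY
    exact (integrable_map_measure hmeas.aestronglyMeasurable hev.aemeasurable).1 hY
  · rw [← hint]
    change ∫ ω : ℕ → Obs X S, (fun z : Obs X S => z.2.2) (ω (k + n)) ∂M.pathLaw π init = _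
    rw [← integral_map hev.aemeasurable hmeas.aestronglyMeasurable, pathLaw_map_add h,
      integral_comp_measure hY]
    simp_rw [hM.integral_outcome]

end MDP

/-! ### Long-run averages and indirect effects -/

namespace MDP

variable {X S : Type*} [MeasurableSpace X] [MeasurableSpace S] [MeasurableSingletonClass S]
  [Fintype S] {M : MDP X S} {π : Policy X S}

/-- This treats both cases of the definition alike: the first state and treatment alone determine
the law of the second state, so nothing else about `init` matters for later outcomes. -/
theorem lawGivenStateTreatment_eq (M : MDP X S) (π : Policy X S) (s : S) (w : Bool) :
    ∃ init : Measure (Obs X S), IsProbabilityMeasure init ∧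
      M.lawGivenStateTreatment π s w = M.pathLaw π init ∧
      ∀ᵐ z ∂init, z.1 = s ∧ z.2.1.2 = w := by
  have hA : MeasurableSet {z : Obs X S | z.2.1.2 = w} :=
    measurableSet_eq_fun (by fun_prop) measurable_const
  have hpre : {ω : ℕ → Obs X S | treatmentAt 0 ω = w} =
      (fun ω => ω 0) ⁻¹' {z | z.2.1.2 = w} := rfl
  rw [lawGivenStateTreatment, hpre, lawGivenState, cond_pathLaw hA]
  split_ifs with h
  · exact ⟨_, inferInstance, rfl,
      (ae_unitKernel_fst s).and (ae_unitKernel_const_treatment s w)⟩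
  · refine ⟨ProbabilityTheory.cond (M.unitKernel π s) {z | z.2.1.2 = w}, ?_, rfl,
      Filter.Eventually.and (cond_absolutelyContinuous.ae_le (ae_unitKernel_fst s))
        (ae_cond_mem hA)⟩
    refine cond_isProbabilityMeasure fun h0 => h ?_
    have hev : Measurable fun ω : ℕ → Obs X S => ω 0 := measurable_pi_apply 0
    have hmap := congrArg (fun μ => μ {z : Obs X S | z.2.1.2 = w})
      (pathLaw_map_zero (M := M) (π := π) (init := M.unitKernel π s))
    rw [Measure.map_apply hev hA] at hmap
    exact hmap.trans h0

variable [DecidableEq S]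

theorem BoundedOutcomes.integral_outcomeAt_givenState (hM : M.BoundedOutcomes) (s : S) (n : ℕ) :
    Integrable (outcomeAt n) (M.lawGivenState π s) ∧ ∫ ω, outcomeAt n ω ∂M.lawGivenState π s =
      ((M.transMatrix π.1 ^ n).mulVec (M.meanReward π.1)) s := by
  have h : (M.pathLaw π (M.unitKernel π s)).map (fun ω => ω 0) =
      M.unitKernel π ∘ₘ Measure.dirac s := by
    rw [pathLaw_map_zero, Measure.dirac_bind (Kernel.measurable _)]
  simpa [lawGivenState] using hM.integral_outcomeAt h n

theorem BoundedOutcomes.integral_outcomeAt_givenStateTreatment (hM : M.BoundedOutcomes) (s : S)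
    (w : Bool) (n : ℕ) :
    Integrable (outcomeAt (n + 1)) (M.lawGivenStateTreatment π s w) ∧
      ∫ ω, outcomeAt (n + 1) ω ∂M.lawGivenStateTreatment π s w =
        ∑ s', (M.PS s w s').toReal *
          ((M.transMatrix π.1 ^ n).mulVec (M.meanReward π.1)) s' := by
  obtain ⟨init, hinit, heq, hae⟩ := M.lawGivenStateTreatment_eq π s w
  have hnext : M.nextStateKernel ∘ₘ init = M.stateKernel (s, w) := by
    have : ∀ᵐ z ∂init, M.nextStateKernel z = Kernel.const (Obs X S) (M.stateKernel (s, w)) z := by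
      filter_upwards [hae] with z hz
      rw [nextStateKernel, Kernel.comap_apply, Kernel.const_apply, hz.1, hz.2]
    rw [Measure.comp_congr this, Measure.const_comp, measure_univ, one_smul]
  have h : (M.pathLaw π init).map (fun ω => ω 1) = M.unitKernel π ∘ₘ M.stateKernel (s, w) := by
    rw [← hnext, Measure.comp_assoc]
    have := pathLaw_map_succ (M := M) (π := π) (init := init) 0
    rwa [pathLaw_map_zero] at this
  rw [heq]
  simpa only [add_comm, integral_stateKernel] using hM.integral_outcomeAt h n

variable [Nonempty S]

theorem tendsto_average (hM : M.BoundedOutcomes) (hirr : (M.transMatrix π.1).IsIrreducible)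
    (haper : IsAperiodic (M.transMatrix π.1)) (s : S) :
    Tendsto (fun n : ℕ => ∫ ω, 1 / (n : ℝ) * ∑ i ∈ Finset.Icc 1 n, outcomeAt (i - 1) ω
      ∂M.lawGivenState π s) atTop (𝓝 (M.avgOutcome π.1)) := by
  obtain ⟨m, hm⟩ := exists_pow_pos hirr haper
  have hd := isStationary_iff.1 (statDist_spec π.2 hirr haper).1
  rw [avgOutcome_eq hM π.2]
  have h := (tendsto_pi_nhds.1 (tendsto_pow_mulVec (M.transMatrix_nonneg π.2)
    (M.transMatrix_mulVec_one π.2) hm hd.1 hd.2.1 hd.2.2 (M.meanReward π.1)) s).cesaro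
  refine h.congr fun n => ?_
  rw [integral_const_mul, integral_finsetSum _
    fun i _ => (hM.integral_outcomeAt_givenState s (i - 1)).1, one_div]
  simp_rw [fun i => (hM.integral_outcomeAt_givenState (π := π) s i).2]
  rw [← Finset.Ico_add_one_right_eq_Icc, Finset.sum_Ico_eq_sum_range]
  simp

theorem tendsto_centredTail (hM : M.BoundedOutcomes) (hirr : (M.transMatrix π.1).IsIrreducible)
    (haper : IsAperiodic (M.transMatrix π.1)) {V : S → ℝ}
    (hV : M.IsPoisson π.1 (M.meanReward π.1) V) (s : S) (w : Bool) :
    Tendsto (M.centredTail π s w) atTop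
      (𝓝 (∑ s', (M.PS s w s').toReal * (V s' - M.statDist π.1 ⬝ᵥ V))) := by
  obtain ⟨m, hm⟩ := exists_pow_pos hirr haper
  have hd := isStationary_iff.1 (statDist_spec π.2 hirr haper).1
  have h : Tendsto (fun n : ℕ => ∑ s', (M.PS s w s').toReal * ∑ k ∈ Finset.range n,
      (((M.transMatrix π.1 ^ k).mulVec (M.meanReward π.1)) s' - M.avgOutcome π.1)) atTop
      (𝓝 (∑ s', (M.PS s w s').toReal * (V s' - M.statDist π.1 ⬝ᵥ V))) := by
    rw [avgOutcome_eq hM π.2]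
    exact tendsto_finsetSum _ fun s' _ => (tendsto_sum_pow_mulVec (M.transMatrix_nonneg π.2)
      (M.transMatrix_mulVec_one π.2) hm hd.1 hd.2.1 hd.2.2 hV s').const_mul _
  -- Units 2 to `n` give `n - 1` terms; the term with index `k` sits at coordinate `k + 1`, which is
  -- `k` transitions after the second state.
  refine (h.comp (tendsto_sub_atTop_nat 1)).congr fun n => ?_
  obtain ⟨init, hinit, heq, -⟩ := M.lawGivenStateTreatment_eq π s w
  have : IsProbabilityMeasure (M.lawGivenStateTreatment π s w) := by rw [heq]; infer_instance
  have hY (n : ℕ) := hM.integral_outcomeAt_givenStateTreatment (π := π) s w n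
  have hi (i : ℕ) (hi : i ∈ Finset.Icc 2 n) :
      Integrable (fun ω => outcomeAt (i - 1) ω - M.avgOutcome π.1)
        (M.lawGivenStateTreatment π s w) := by
    obtain ⟨j, rfl⟩ := Nat.exists_eq_add_of_le' (Finset.mem_Icc.1 hi).1
    exact (hY j).1.sub (integrable_const _)
  rw [Function.comp_apply, centredTail,
    integral_finsetSum _ fun i h => hi i h, ← Finset.Ico_add_one_right_eq_Icc,
    Finset.sum_Ico_eq_sum_range]
  simp_rw [Finset.mul_sum]
  rw [Finset.sum_comm]
  refine Finset.sum_congr rfl fun k _ => ?_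
  have hk : 2 + k - 1 = k + 1 := by omega
  rw [hk, integral_sub (hY k).1 (integrable_const _), (hY k).2]
  simp_rw [mul_sub, Finset.sum_sub_distrib, ← Finset.sum_mul, sum_toReal_PS]
  simp

theorem caie_eq_indirectEffect (hM : M.BoundedOutcomes)
    (hirr : (M.transMatrix π.1).IsIrreducible) (haper : IsAperiodic (M.transMatrix π.1))
    {V : S → ℝ} (hV : M.IsPoisson π.1 (M.meanReward π.1) V) (s : S) :
    M.caie π s = M.indirectEffect V s := by
  rw [caie, (tendsto_centredTail hM hirr haper hV s true).limUnder_eq,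
    (tendsto_centredTail hM hirr haper hV s false).limUnder_eq, indirectEffect]
  simp_rw [mul_sub, Finset.sum_sub_distrib, ← Finset.sum_mul, sum_toReal_PS]
  ring

/-! ### The policy gradient and its pointwise form -/

theorem hasDerivWithinAt_avgOutcome_caie (hM : M.BoundedOutcomes)
    (hirr : ∀ π : Policy X S, (M.transMatrix π.1).IsIrreducible)
    (haper : ∀ π : Policy X S, IsAperiodic (M.transMatrix π.1)) (π : Policy X S) {h : X → S → ℝ}
    (hh : ∀ s, Measurable fun x => h x s) :
    HasDerivWithinAt (fun t : ℝ => M.avgOutcome fun x s => π.1 x s + t * h x s)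
      (∫ x, ∑ s, M.statDist π.1 s * (M.cade x s + M.caie π s) * h x s ∂M.covLaw)
      {t : ℝ | IsPolicy fun x s => π.1 x s + t * h x s} 0 := by
  obtain ⟨V, hV⟩ := exists_isPoisson π.2 (hirr π) (haper π) (M.meanReward π.1)
  simp_rw [caie_eq_indirectEffect hM (hirr π) (haper π) hV]
  exact hasDerivWithinAt_avgOutcome hM hirr haper π.2 hV hh

/-- The gradient of the average outcome. -/
def policyGradient (M : MDP X S) (π : Policy X S) (x : X) (s : S) : ℝ :=
  M.pX x * (M.statDist π.1 s * (M.cade x s + M.caie π s))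

theorem hasPolicyGradient (hM : M.BoundedOutcomes)
    (hirr : ∀ π : Policy X S, (M.transMatrix π.1).IsIrreducible)
    (haper : ∀ π : Policy X S, IsAperiodic (M.transMatrix π.1)) (π : Policy X S) :
    M.HasPolicyGradient π.1 (M.policyGradient π) := by
  constructor
  · intro s
    have h := ((hM.integrable_cade s).add (integrable_const (M.caie π s))).const_mul
      (M.statDist π.1 s)
    exact (integrable_withDensity_iff_integrable_smul M.measurable_pX).1 h
  · intro h hh
    have := hasDerivWithinAt_avgOutcome_caie hM hirr haper π hh
    rw [covLaw, integral_withDensity_eq_integral_smul M.measurable_pX] at this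
    simpa only [policyGradient, NNReal.smul_def, smul_eq_mul, Finset.mul_sum, mul_assoc] using this

theorem condPolicyGradient_eq (hM : M.BoundedOutcomes)
    (hirr : ∀ π : Policy X S, (M.transMatrix π.1).IsIrreducible)
    (haper : ∀ π : Policy X S, IsAperiodic (M.transMatrix π.1)) (π : Policy X S)
    {G : X → S → ℝ} (hG : M.HasPolicyGradient π.1 G) :
    ∀ᵐ x ∂M.covLaw, ∀ s, M.condPolicyGradient π.1 G x s = M.cade x s + M.caie π s := by
  have hae : ∀ᵐ x ∂M.ν, ∀ s, G x s = M.policyGradient π x s :=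
    ae_all_iff.2 fun s => hG.ae_eq π.2 (hasPolicyGradient hM hirr haper π) s
  have hpos := (statDist_spec π.2 (hirr π) (haper π)).2.2
  -- Passing to `M.ν` leaves only points with nonzero density, where the division in
  -- `condPolicyGradient` is genuine.
  rw [covLaw, ae_withDensity_iff M.measurable_pX.coe_nnreal_ennreal]
  filter_upwards [hae] with x hx hx0 s
  have h0 : (M.pX x : ℝ) ≠ 0 := by
    simpa using hx0
  have h1 := (hpos s).ne'
  rw [condPolicyGradient, hx s, policyGradient]
  field_simp

theorem hasDerivWithinAt_avgOutcome_setAt (hM : M.BoundedOutcomes)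
    (hirr : ∀ π : Policy X S, (M.transMatrix π.1).IsIrreducible)
    (haper : ∀ π : Policy X S, IsAperiodic (M.transMatrix π.1)) (π : Policy X S) {x : X} (s : S)
    (hx : MeasurableSet {x}) :
    HasDerivWithinAt (fun p : ℝ => M.avgOutcome (setAt π.1 x s p))
      (M.covLaw.real {x} * M.statDist π.1 s * (M.cade x s + M.caie π s))
      (Set.Icc 0 1) (π.1 x s) := by
  let h : X → S → ℝ := fun x' s' => if s' = s then Set.indicator {x} 1 x' else 0
  have hh (s' : S) : Measurable fun x => h x s' := by
    by_cases hs : s' = s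
    · simpa [h, hs] using measurable_one.indicator hx
    · simp [h, hs]
  -- Changing a single value is a perturbation along the indicator of the point, with parameter `p -
  -- π.1 x s`; the chain rule then gives the derivative in `p`.
  have hset (p : ℝ) : setAt π.1 x s p = fun x' s' => π.1 x' s' + (p - π.1 x s) * h x' s' := by
    funext x' s'
    by_cases hs : s' = s
    · by_cases hx' : x' = x
      · simp [setAt, h, hs, hx']
      · simp [setAt, h, hs, hx']
    · simp [setAt, h, hs]
  have hmaps : Set.MapsTo (fun p => p - π.1 x s) (Set.Icc 0 1)
      {t : ℝ | IsPolicy fun x s => π.1 x s + t * h x s} := by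
    intro p hp
    change IsPolicy fun x' s' => π.1 x' s' + (p - π.1 x s) * h x' s'
    have hbd (x' : X) (s' : S) : 0 ≤ setAt π.1 x s p x' s' ∧ setAt π.1 x s p x' s' ≤ 1 := by
      unfold setAt
      split_ifs
      exacts [hp, ⟨π.2.nonneg x' s', π.2.le_one x' s'⟩]
    rw [hset] at hbd
    exact ⟨fun s' => (π.2.measurable s').add ((hh s').const_mul _),
      fun x' s' => (hbd x' s').1, fun x' s' => (hbd x' s').2⟩
  have hderiv := hasDerivWithinAt_avgOutcome_caie hM hirr haper π hh
  have hval : ∫ x', ∑ s', M.statDist π.1 s' * (M.cade x' s' + M.caie π s') * h x' s' ∂M.covLaw =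
      M.covLaw.real {x} * M.statDist π.1 s * (M.cade x s + M.caie π s) := by
    have hpt (x' : X) : ∑ s', M.statDist π.1 s' * (M.cade x' s' + M.caie π s') * h x' s' =
        Set.indicator {x} (fun _ => M.statDist π.1 s * (M.cade x s + M.caie π s)) x' := by
      by_cases hx' : x' = x <;> simp [h, hx']
    simp_rw [hpt]
    rw [integral_indicator_const _ hx, smul_eq_mul, mul_assoc]
  rw [hval] at hderiv
  simp_rw [hset]
  have hsub : HasDerivWithinAt (fun p : ℝ => p - π.1 x s) 1 (Set.Icc 0 1) (π.1 x s) :=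
    (hasDerivWithinAt_id _ _).sub_const _
  have hcomp := HasDerivWithinAt.scomp (π.1 x s) (by simpa using hderiv) hsub hmaps
  simpa using! hcomp

end MDP

end

end DynamicTargeting

theorem proposition1 {X S : Type*} [MeasurableSpace X] [MeasurableSpace S]
    [MeasurableSingletonClass S] [Fintype S] [DecidableEq S] [Nonempty S]
    (M : DynamicTargeting.MDP X S)
    (hirr : ∀ π : DynamicTargeting.Policy X S, (M.transMatrix π.1).IsIrreducible)
    (haper : ∀ π : DynamicTargeting.Policy X S, DynamicTargeting.IsAperiodic (M.transMatrix π.1))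
    (hbdd : M.BoundedOutcomes) (π : DynamicTargeting.Policy X S) :
    -- `d_π` is the unique stationary distribution, it is positive, and `μ(π)` is the long-run
    -- average outcome from every initial state
    (M.IsStationary π.1 (M.statDist π.1) ∧
      (∀ d, M.IsStationary π.1 d → d = M.statDist π.1) ∧ (∀ s, 0 < M.statDist π.1 s) ∧
      ∀ s, Tendsto (fun n : ℕ => ∫ ω, 1 / (n : ℝ) * ∑ i ∈ Finset.Icc 1 n,
        DynamicTargeting.MDP.outcomeAt (i - 1) ω ∂M.lawGivenState π s)
        atTop (𝓝 (M.avgOutcome π.1))) ∧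
    -- the limits in the definition of `C_π(s)` exist
    (∀ s w, ∃ c : ℝ, Tendsto (M.centredTail π s w) atTop (𝓝 c)) ∧
    -- the gradient of `μ` at `π` exists
    (∃ G, M.HasPolicyGradient π.1 G) ∧
    -- the decomposition `H(x, s; π) = τ(x, s) + C_π(s)`
    (∀ G, M.HasPolicyGradient π.1 G → ∀ᵐ x ∂M.covLaw, ∀ s,
      M.condPolicyGradient π.1 G x s = M.cade x s + M.caie π s) ∧
    -- the pointwise form: the partial derivative of `μ` in the single value `π(x, s)`
    (∀ x s, MeasurableSet {x} →
      HasDerivWithinAt (fun p : ℝ => M.avgOutcome (DynamicTargeting.setAt π.1 x s p))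
        (M.covLaw.real {x} * M.statDist π.1 s * (M.cade x s + M.caie π s))
        (Set.Icc 0 1) (π.1 x s)) := by
  have hstat := DynamicTargeting.MDP.statDist_spec π.2 (hirr π) (haper π)
  obtain ⟨V, hV⟩ :=
    DynamicTargeting.MDP.exists_isPoisson π.2 (hirr π) (haper π) (M.meanReward π.1)
  exact ⟨⟨hstat.1, hstat.2.1, hstat.2.2,
      DynamicTargeting.MDP.tendsto_average hbdd (hirr π) (haper π)⟩,
    fun s w => ⟨_, DynamicTargeting.MDP.tendsto_centredTail hbdd (hirr π) (haper π) hV s w⟩,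
    ⟨_, DynamicTargeting.MDP.hasPolicyGradient hbdd hirr haper π⟩,
    fun G hG => DynamicTargeting.MDP.condPolicyGradient_eq hbdd hirr haper π hG,
    fun x s hx => DynamicTargeting.MDP.hasDerivWithinAt_avgOutcome_setAt hbdd hirr haper π s hx⟩
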